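/- **Setting.** Let $P$ be a simple polygon in the Euclidean plane with edge set $E$, and let $\delta\colon E\to\mathbb{R}_{\ge 0}$ be additive weights. For $e\in E$ let $\overline e$ be the supporting line of $e$ and $n_e$ its inward facing unit normal, and for $t\ge 0$ put $\overline e(t)=\overline e+\max(0,t-\delta(e))\cdot n_e$. The *additively-weighted wavefront* $\mathcal W_{P,\delta}(t)$ is a finite set of simple polygons ("wavefront polygons"), each edge of which emanates from (is labelled by) an edge of $P$, that evolves with time as follows. 1. At time $0$ it consists of $P$ only, every edge emanating from itself. 2. There are finitely many event times. Between successive events each wavefront polygon keeps its cyclic sequence of labelled edges and stays a simple polygon; an edge emanating from $e$ lies on $\overline e(t)$ at time $t$ and $n_e$ points into the wavefront polygon there, so that each wavefront vertex lies on the translated supporting lines of both incident edges. A vertex whose two incident edges are parallel moves only perpendicularly to them. 3. At an event each wavefront polygon, which may have degenerated, is replaced by finitely many (possibly zero) wavefront polygons. Up to finitely many points, their edges cover exactly the edges of the degenerated polygon minus the portions common to two edges that have moved into each other from opposite sides (so edges of length zero disappear, and the polygon is split where its boundary touches itself). Edges keep their labels, except that when edges with the same inward normal form a common straight edge and at least one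 of them starts to move at that time or earlier, one of them may take over the other. 4. The process ends when no wavefront polygon is left; the wavefront is empty from then on. We identify $\mathcal W_{P,\delta}(t)$ with the closed subset of the plane covered by its polygons (boundary and interior). **Lemma (nested wavefronts).** For every simple polygon $P$, all weights $\delta\ge 0$, every such propagation process, and all $0\le t_1<t_2$, $$\mathcal W_{P,\delta}(t_2)\subseteq\mathcal W_{P,\delta}(t_1).$$ The inclusion need not be proper: there are $P$, $\delta\ge 0$, a propagation process, and $0\le t_1<t_2$ with $\mathcal W_{P,\delta}(t_2)=\mathcal W_{P,\delta}(t_1)\neq\emptyset$. -/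

import Mathlib

open Set Filter Topology

noncomputable section

namespace StraightSkeleton

/-- The Euclidean plane. -/
abbrev Plane : Type := EuclideanSpace ℝ (Fin 2)

/-! ### Simple polygons -/

section Polygon

variable {n : ℕ}

/-- The `i`-th edge of the closed polygonal chain with (cyclically indexed) vertices `v`. -/
def edge (v : ZMod n → Plane) (i : ZMod n) : Set Plane :=
  segment ℝ (v i) (v (i + 1))

/-- The closed polygonal curve with vertices `v`. -/
def curve (v : ZMod n → Plane) : Set Plane := ⋃ i, edge v i

/-- The closed region bounded by the curve: the curve together with all bounded connected
components of its complement. -/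
def region (v : ZMod n → Plane) : Set Plane :=
  curve v ∪ {x | x ∉ curve v ∧ Bornology.IsBounded (connectedComponentIn (curve v)ᶜ x)}

/-- The vertices `v` (in cyclic order, clockwise or counterclockwise) form a simple polygon:
there are at least three, edges have positive length, consecutive edges share only their common
vertex, and non-consecutive edges are disjoint. -/
structure IsSimplePolygon (v : ZMod n → Plane) : Prop where
  three_le : 3 ≤ n
  edge_ne : ∀ i, v i ≠ v (i + 1)
  consecutive : ∀ i, edge v i ∩ edge v (i + 1) = {v (i + 1)}
  nonconsecutive : ∀ i j, j ≠ i → j ≠ i + 1 → i ≠ j + 1 → Disjoint (edge v i) (edge v j)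

/-- At the `i`-th edge of the polygon `v`, the vector `ν` points into the bounded region. -/
def PointsInward (v : ZMod n → Plane) (i : ZMod n) (ν : Plane) : Prop :=
  ∀ x ∈ openSegment ℝ (v i) (v (i + 1)), ∀ᶠ ε in 𝓝[>] (0 : ℝ), x + ε • ν ∈ region v

/-- The unit normal of the directed segment from `a` to `b` pointing to its left. -/
def leftNormal (a b : Plane) : Plane := ‖b - a‖⁻¹ • !₂[-(b - a) 1, (b - a) 0]

open Classical in
/-- The inward facing unit normal `n_e` of the edge `e` of the polygon `p`. -/
def inwardNormal (p : ZMod n → Plane) (e : ZMod n) : Plane :=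
  if PointsInward p e (leftNormal (p e) (p (e + 1))) then leftNormal (p e) (p (e + 1))
  else -leftNormal (p e) (p (e + 1))

/-- How far the edge `e` has moved at time `t`: it starts at time `δ e` and has unit speed. -/
def offset (δ : ZMod n → ℝ) (e : ZMod n) (t : ℝ) : ℝ := max 0 (t - δ e)

/-- The supporting line of the edge `e` of `p`, translated by `max (0, t - δ e)` in the direction
of the inward normal of `e`. -/
def offsetLine (p : ZMod n → Plane) (δ : ZMod n → ℝ) (e : ZMod n) (t : ℝ) : Set Plane :=
  (fun y => y + offset δ e t • inwardNormal p e) '' (line[ℝ, p e, p (e + 1)] : Set Plane)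

end Polygon

/-! ### Wavefront polygons -/

/-- A moving polygon: at time `t` its vertices, in cyclic order, are `vertex t j`, and its `j`-th
edge, from `vertex t j` to `vertex t (j + 1)`, emanates from the input edge `label j ∈ E`. -/
structure MovingPolygon (E : Type) where
  size : ℕ
  label : ZMod size → E
  vertex : ℝ → ZMod size → Plane

variable {n : ℕ}

namespace MovingPolygon

/-- At time `t` the moving polygon is a simple polygon, and at each of its edges the inward normal
of the input edge from which that edge emanates points into the polygon. -/
def IsWavefrontPolygonAt (K : MovingPolygon (ZMod n)) (p : ZMod n → Plane) (t : ℝ) : Prop :=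
  IsSimplePolygon (K.vertex t) ∧
    ∀ j, PointsInward (K.vertex t) j (inwardNormal p (K.label j))

/-- The motion of a wavefront polygon between two successive events at times `a ≤ b`. -/
structure MovesBetween (K : MovingPolygon (ZMod n)) (p : ZMod n → Plane) (δ : ZMod n → ℝ)
    (a b : ℝ) : Prop where
  /-- Before the event at time `b` the polygon is a proper wavefront polygon. -/
  planar : ∀ t, (t = a ∨ a ≤ t ∧ t < b) → K.IsWavefrontPolygonAt p t
  /-- Each edge moves inwards in a self-parallel manner on the translated supporting line of its
  input edge, and incidences are preserved. -/
  incident : ∀ t ∈ Icc a b, ∀ j, K.vertex t j ∈ offsetLine p δ (K.label j) t ∧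
    K.vertex t (j + 1) ∈ offsetLine p δ (K.label j) t
  /-- A vertex whose two incident edges are parallel (interior angle 180 degrees) is not determined
  by the incidences; it does not slide along the edges, i.e. it moves perpendicularly to them. -/
  tangential : ∀ j, (inwardNormal p (K.label (j + 1)) = inwardNormal p (K.label j) ∨
      inwardNormal p (K.label (j + 1)) = -inwardNormal p (K.label j)) →
    ∀ t ∈ Icc a b, K.vertex t (j + 1) = K.vertex a (j + 1) +
      (offset δ (K.label j) t - offset δ (K.label j) a) • inwardNormal p (K.label j)

end MovingPolygon

/-- The union of all edges of the moving polygon `K` at time `t` that emanate from `e`. -/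
def fragments (K : MovingPolygon (ZMod n)) (e : ZMod n) (t : ℝ) : Set Plane :=
  ⋃ j, ⋃ (_ : K.label j = e), edge (K.vertex t) j

/-- Restoring planarity at time `t`: the wavefront polygon `K`, which may have degenerated at time
`t`, is replaced by the (possibly empty) list `L` of wavefront polygons. -/
structure Resolves (p : ZMod n → Plane) (δ : ZMod n → ℝ) (t : ℝ)
    (K : MovingPolygon (ZMod n)) (L : List (MovingPolygon (ZMod n))) : Prop where
  /-- Up to finitely many points, the boundary is kept, except that the portions common to two
  edges which have moved into each other from opposite sides are removed. (In particular edges of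
  length zero disappear, and the polygon is split where its boundary touches itself.) -/
  boundary : ∀ e,
    (symmDiff (⋃ K' ∈ L, ⋃ e' ∈ {e' | inwardNormal p e' = inwardNormal p e}, fragments K' e' t)
      ((⋃ e' ∈ {e' | inwardNormal p e' = inwardNormal p e}, fragments K e' t) \
        ⋃ e' ∈ {e' | inwardNormal p e' = -inwardNormal p e}, fragments K e' t)).Finite
  /-- A new edge with label `e` contains a piece of an old edge with label `e`. -/
  label_old : ∀ K' ∈ L, ∀ j, (edge (K'.vertex t) j ∩ fragments K (K'.label j) t).Infinite
  /-- A new edge with label `e` contains no piece of an old edge with another label `e'` and the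
  same inward normal, unless `e` or `e'` starts to move at time `t` or earlier: when collinear
  edges are adjacent and do not move alike, one of them takes over the other. -/
  label_other : ∀ K' ∈ L, ∀ j, ∀ e', e' ≠ K'.label j →
    inwardNormal p e' = inwardNormal p (K'.label j) →
    (edge (K'.vertex t) j ∩ fragments K e' t).Infinite → δ (K'.label j) ≤ t ∨ δ e' ≤ t

/-! ### The propagation process -/

/-- A wavefront propagation of the simple polygon `p` with additive weights `δ`: finitely many
events at times `0 = time 0 ≤ time 1 ≤ ⋯ ≤ time N`. From `time i` on and before `time (i + 1)` the
wavefront consists of the polygons in the list `polygons i`. -/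
structure Propagation (p : ZMod n → Plane) (δ : ZMod n → ℝ) where
  N : ℕ
  time : ℕ → ℝ
  polygons : ℕ → List (MovingPolygon (ZMod n))
  time_zero : time 0 = 0
  time_le : ∀ i < N, time i ≤ time (i + 1)
  /-- Initially the wavefront is the polygon `p`, and each edge emanates from itself. -/
  initial : ∃ v : ℝ → ZMod n → Plane, polygons 0 = [⟨n, id, v⟩] ∧ v 0 = p
  /-- Between events the polygons move. -/
  moves : ∀ i < N, ∀ K ∈ polygons i, K.MovesBetween p δ (time i) (time (i + 1))
  /-- At events planarity is restored: each polygon is replaced by finitely many polygons. -/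
  event : ∀ i < N, ∃ successors : MovingPolygon (ZMod n) → List (MovingPolygon (ZMod n)),
    (∀ K ∈ polygons i, Resolves p δ (time (i + 1)) K (successors K)) ∧
      polygons (i + 1) = (polygons i).flatMap successors
  /-- The process ends when all wavefront polygons have collapsed. -/
  final : polygons N = []

/-- The wavefront at time `t`, as the closed subset of the plane covered by the wavefront
polygons at time `t`. It is empty after the end of the process. -/
def Propagation.wavefront {p : ZMod n → Plane} {δ : ZMod n → ℝ} (W : Propagation p δ) (t : ℝ) :
    Set Plane :=
  {x | ∃ i < W.N, W.time i ≤ t ∧ t < W.time (i + 1) ∧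
    ∃ K ∈ W.polygons i, x ∈ region (K.vertex t)}

end StraightSkeleton

end

noncomputable section

namespace StraightSkeleton

/-! ### The plane -/

/-! Everything rests on a topological description of the region: a point lies outside it exactly
when an unbounded connected set containing the point misses the curve. Hence a curve contained in a
region drags its whole region along (`region_subset_region`), and inclusions need only be checked on
boundaries.

Between events, suppose that x is in the region at time t but not at an earlier time s. Join x,
outside the earlier region, to a point z farther out than every curve during [s, t]. The moving
curve must hit this fixed path, for otherwise x would be outside at time t; let τ be the first time
of contact and y a contact point. Edges move inwards, so slightly before τ the point y lies on the
inward side of the edges near it and belongs to the region (`InwardMotion.eventually_mem_region`).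
But before τ the path misses the curve and leads from y to z, so y is outside, a contradiction. This
is `InwardMotion.region_subset`; it needs no global control of the polygon, only the local picture
at an edge or a vertex.

At an event the old polygon may be degenerate, but its curve is a limit of earlier curves and so
stays in the closed earlier region (`MovesBetween.curve_subset`). The new curves lie on the old one:
they do up to finitely many points, and a nondegenerate segment is the closure of what remains of it
(`Resolves.curve_subset`). Induction over the events gives the nesting.

For equality, a 3-4-5 triangle whose edges all have weight 1 rests until time 1. -/

theorem plane_inner_eq (x y : Plane) : inner ℝ x y = x 0 * y 0 + x 1 * y 1 := by
  simp [PiLp.inner_apply, Fin.sum_univ_two, mul_comm]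

theorem plane_norm_sq (x : Plane) : ‖x‖ ^ 2 = x 0 ^ 2 + x 1 ^ 2 := by
  rw [← real_inner_self_eq_norm_sq, plane_inner_eq]; ring

theorem plane_ext {x y : Plane} (h0 : x 0 = y 0) (h1 : x 1 = y 1) : x = y := by
  ext i; fin_cases i <;> assumption

/-- Two vectors orthogonal to a common unit vector are proportional. -/
theorem exists_smul_of_inner_eq_zero {ν A w : Plane} (hν : ‖ν‖ = 1) (hA : A ≠ 0)
    (hAν : inner ℝ A ν = 0) (hw : inner ℝ w ν = 0) : ∃ r : ℝ, w = r • A := by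
  have hn := plane_norm_sq ν
  rw [hν] at hn
  rw [plane_inner_eq] at hAν hw
  have hA2 : A 0 ^ 2 + A 1 ^ 2 ≠ 0 := by
    rw [← plane_norm_sq]; positivity
  have hdet : w 0 * A 1 - w 1 * A 0 = 0 := by
    linear_combination (w 0 * A 1 - w 1 * A 0) * hn + (A 1 * ν 0 - A 0 * ν 1) * hw
      - (w 1 * ν 0 - w 0 * ν 1) * hAν
  refine ⟨(w 0 * A 0 + w 1 * A 1) / (A 0 ^ 2 + A 1 ^ 2), plane_ext ?_ ?_⟩
  · simp only [PiLp.smul_apply, smul_eq_mul]; field_simp; linear_combination A 1 * hdet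
  · simp only [PiLp.smul_apply, smul_eq_mul]; field_simp; linear_combination -A 0 * hdet

variable {n : ℕ}

/-! ### Regions -/

theorem isCompact_edge (v : ZMod n → Plane) (i : ZMod n) : IsCompact (edge v i) := by
  rw [edge, segment_eq_image_lineMap]
  exact isCompact_Icc.image (AffineMap.lineMap_continuous)

theorem isClosed_curve [NeZero n] (v : ZMod n → Plane) : IsClosed (curve v) :=
  isClosed_iUnion_of_finite fun i => (isCompact_edge v i).isClosed

theorem curve_subset_region (v : ZMod n → Plane) : curve v ⊆ region v := subset_union_left

theorem notMem_region_of_unbounded {v : ZMod n → Plane} {S : Set Plane} (hS : IsPreconnected S)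
    (hSv : Disjoint S (curve v)) (hb : ¬ Bornology.IsBounded S) {x : Plane} (hx : x ∈ S) :
    x ∉ region v := by
  rintro (h | ⟨_, h⟩)
  · exact Set.disjoint_left.1 hSv hx h
  · exact hb (h.subset (hS.subset_connectedComponentIn hx hSv.subset_compl_right))

theorem mem_region_of_preconnected {v : ZMod n → Plane} {S : Set Plane} (hS : IsPreconnected S)
    (hSv : Disjoint S (curve v)) {x y : Plane} (hx : x ∈ S) (hy : y ∈ S) (h : x ∈ region v) :
    y ∈ region v := by
  rcases h with h | ⟨_, h⟩
  · exact absurd h (Set.disjoint_left.1 hSv hx)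
  · refine Or.inr ⟨Set.disjoint_left.1 hSv hy, ?_⟩
    rwa [← connectedComponentIn_eq
      (hS.subset_connectedComponentIn hx hSv.subset_compl_right hy)]

/-- A point outside the region lies in an unbounded connected open set that avoids the region. -/
theorem exists_unbounded_of_notMem_region [NeZero n] {v : ZMod n → Plane} {x : Plane}
    (hx : x ∉ region v) : ∃ V : Set Plane, IsOpen V ∧ IsPreconnected V ∧ x ∈ V ∧
      ¬ Bornology.IsBounded V ∧ Disjoint V (region v) := by
  have hxc : x ∈ (curve v)ᶜ := fun h => hx (Or.inl h)
  have hb : ¬ Bornology.IsBounded (connectedComponentIn (curve v)ᶜ x) :=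
    fun h => hx (Or.inr ⟨hxc, h⟩)
  refine ⟨_, (isClosed_curve v).isOpen_compl.connectedComponentIn,
    isPreconnected_connectedComponentIn, mem_connectedComponentIn hxc, hb, ?_⟩
  refine Set.disjoint_left.2 fun y hy => notMem_region_of_unbounded
    isPreconnected_connectedComponentIn ?_ hb hy
  exact Set.subset_compl_iff_disjoint_right.1 (connectedComponentIn_subset (curve v)ᶜ x)

theorem isClosed_region [NeZero n] (v : ZMod n → Plane) : IsClosed (region v) := by
  rw [← isOpen_compl_iff, isOpen_iff_mem_nhds]
  intro x hx
  obtain ⟨V, hV, -, hxV, -, hd⟩ := exists_unbounded_of_notMem_region hx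
  exact mem_of_superset (hV.mem_nhds hxV) hd.subset_compl_right

/-- A point outside `region v` escapes to infinity through a connected set that misses `region v`,
hence misses `curve w` as well. -/
theorem region_subset_region {m : ℕ} [NeZero n] {v : ZMod n → Plane} {w : ZMod m → Plane}
    (h : curve w ⊆ region v) : region w ⊆ region v := by
  intro x hxw
  by_contra hx
  obtain ⟨V, -, hV, hxV, hb, hd⟩ := exists_unbounded_of_notMem_region hx
  exact notMem_region_of_unbounded hV (hd.mono_right h) hb hxV hxw

/-! ### Points on the inward side of edges -/

/-- Near an edge, the points of a convex open set on the inward side of the edge belong to the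
region, if that part of the set avoids the curve. -/
theorem mem_region_of_pointsInward {v : ZMod n → Plane} {i : ZMod n} {ν : Plane} (hν : ‖ν‖ = 1)
    (h : PointsInward v i ν) {U : Set Plane} (hUo : IsOpen U) (hUc : Convex ℝ U) {z : Plane}
    (hz : z ∈ openSegment ℝ (v i) (v (i + 1))) (hzU : z ∈ U)
    (hd : ∀ q ∈ U, inner ℝ z ν < inner ℝ q ν → q ∉ curve v) {y : Plane} (hy : y ∈ U)
    (hyz : inner ℝ z ν < inner ℝ y ν) : y ∈ region v := by
  -- The part of `U` strictly beyond the line is convex and misses the curve, so it lies in one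
  -- component of the complement. It contains z + εν for small ε, which is in the region.
  have hconv : Convex ℝ (U ∩ {q | inner ℝ z ν < inner ℝ q ν}) :=
    hUc.inter (convex_halfSpace_gt ⟨fun x y => inner_add_left x y ν,
      fun c x => real_inner_smul_left x ν c⟩ _)
  have hlim : Tendsto (fun ε : ℝ => z + ε • ν) (𝓝[>] 0) (𝓝 z) := by
    have : Tendsto (fun ε : ℝ => z + ε • ν) (𝓝 0) (𝓝 (z + (0 : ℝ) • ν)) :=
      Continuous.tendsto (by fun_prop) 0
    rw [zero_smul, add_zero] at this
    exact this.mono_left nhdsWithin_le_nhds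
  obtain ⟨ε, h1, h2, h3⟩ := ((h z hz).and ((hlim.eventually (hUo.mem_nhds hzU)).and
    self_mem_nhdsWithin)).exists
  refine mem_region_of_preconnected hconv.isPreconnected
    (Set.disjoint_left.2 fun q hq => hd q hq.1 hq.2) ⟨h2, ?_⟩ ⟨hy, hyz⟩ h1
  simp only [mem_ofPred_eq, inner_add_left, real_inner_smul_left, real_inner_self_eq_norm_sq, hν]
  simpa using h3

/-- On the ray from c through d, a point beyond d would put d between two points of the convex set
`U`. -/
theorem mem_segment_of_convex {U : Set Plane} (hU : Convex ℝ U) {c d y : Plane} {r : ℝ}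
    (hr : 0 ≤ r) (hyr : y - c = r • (d - c)) (hc : c ∈ U) (hy : y ∈ U) (hd : d ∉ U) :
    y ∈ segment ℝ c d := by
  have hy' : y = c + r • (d - c) := by rw [← hyr]; abel
  rcases le_or_gt r 1 with h1 | h1
  · rw [segment_eq_image']
    exact ⟨r, ⟨hr, h1⟩, hy'.symm⟩
  · refine absurd (hU.segment_subset hc hy ?_) hd
    rw [segment_eq_image']
    refine ⟨r⁻¹, ⟨by positivity, inv_le_one_of_one_le₀ h1.le⟩, ?_⟩
    simp only
    rw [hyr, smul_smul, inv_mul_cancel₀ (by positivity), one_smul]; abel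

theorem inner_eq_of_mem_segment {a b q ν : Plane} (hab : inner ℝ b ν = inner ℝ a ν)
    (hq : q ∈ segment ℝ a b) : inner ℝ q ν = inner ℝ a ν := by
  rw [segment_eq_image'] at hq
  obtain ⟨r, -, rfl⟩ := hq
  simp only [inner_add_left, inner_smul_left, inner_sub_left, hab]; simp

theorem inner_le_of_mem_segment {a b q ν : Plane} (hab : inner ℝ b ν ≤ inner ℝ a ν)
    (hq : q ∈ segment ℝ a b) : inner ℝ q ν ≤ inner ℝ a ν := by
  rw [segment_eq_image'] at hq
  obtain ⟨r, hr, rfl⟩ := hq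
  simp only [inner_add_left, real_inner_smul_left, inner_sub_left]
  nlinarith [hr.1]

theorem exists_mem_openSegment_of_mem {a b c : Plane} {U : Set Plane} (hU : IsOpen U)
    (hc : c ∈ segment ℝ a b) (hcU : c ∈ U) : ∃ z ∈ openSegment ℝ a b, z ∈ U := by
  obtain ⟨z, hz⟩ := mem_closure_iff.1 (segment_subset_closure_openSegment hc) U hU hcU
  exact ⟨z, hz.2, hz.1⟩

/-- Near an edge of a polygon, the closed inward side of the edge belongs to the region. -/
theorem mem_region_near_edge {v : ZMod n → Plane} {j : ZMod n} {ν : Plane} (hν : ‖ν‖ = 1)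
    (h : PointsInward v j ν) (hp : inner ℝ (v (j + 1)) ν = inner ℝ (v j) ν)
    {U : Set Plane} (hUo : IsOpen U) (hUc : Convex ℝ U)
    (hU : ∀ k, k ≠ j → Disjoint U (edge v k)) (hU₀ : v j ∉ U) (hU₁ : v (j + 1) ∉ U)
    {c : Plane} (hc : c ∈ edge v j) (hcU : c ∈ U) {y : Plane} (hy : y ∈ U)
    (hcy : inner ℝ c ν ≤ inner ℝ y ν) : y ∈ region v := by
  have hcν := inner_eq_of_mem_segment hp hc
  rcases hcy.lt_or_eq with hlt | heq
  · obtain ⟨z, hz, hzU⟩ := exists_mem_openSegment_of_mem hUo hc hcU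
    have hzν := inner_eq_of_mem_segment hp (openSegment_subset_segment ℝ _ _ hz)
    refine mem_region_of_pointsInward hν h hUo hUc hz hzU (fun q hq hzq hqc => ?_) hy
      (by rw [hzν, ← hcν]; exact hlt)
    obtain ⟨k, hk⟩ := mem_iUnion.1 hqc
    by_cases hkj : k = j
    · subst hkj
      rw [inner_eq_of_mem_segment hp hk, hzν] at hzq
      exact lt_irrefl _ hzq
    · exact Set.disjoint_left.1 (hU k hkj) hq hk
  -- Here y is on the supporting line of the edge, and neither endpoint is in `U`, so moving from c
  -- to y within `U` cannot leave the edge. The sign of r tells which endpoint lies ahead.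
  · refine curve_subset_region v (mem_iUnion.2 ⟨j, ?_⟩)
    have hcne : c ≠ v (j + 1) := fun h => hU₁ (h ▸ hcU)
    obtain ⟨r, hr⟩ := exists_smul_of_inner_eq_zero (w := y - c) hν (sub_ne_zero.2 hcne.symm)
      (by rw [inner_sub_left, hp, hcν, sub_self]) (by rw [inner_sub_left, heq, sub_self])
    rcases le_total 0 r with h0 | h0
    · exact (convex_segment _ _).segment_subset hc (right_mem_segment ℝ _ _)
        (mem_segment_of_convex hUc h0 hr hcU hy hU₁)
    · have hcne' : c ≠ v j := fun h => hU₀ (h ▸ hcU)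
      have hc' := hc
      rw [edge, segment_eq_image'] at hc'
      obtain ⟨l, hl, hlc⟩ := hc'
      simp only at hlc
      have hl0 : l ≠ 0 := by rintro rfl; exact hcne' (by rw [← hlc]; simp)
      have hl0 : 0 < l := lt_of_le_of_ne hl.1 hl0.symm
      refine (convex_segment _ _).segment_subset hc (left_mem_segment ℝ _ _)
        (mem_segment_of_convex hUc (r := -r * (1 - l) / l) ?_ ?_ hcU hy hU₀)
      · exact div_nonneg (mul_nonneg (by linarith) (by linarith [hl.2])) hl0.le
      · rw [hr, ← hlc]
        ext i
        simp only [PiLp.smul_apply, PiLp.sub_apply, PiLp.add_apply, smul_eq_mul]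
        field_simp
        ring

/-- Near a vertex of a polygon, the points on the closed inward sides of both incident edges
belong to the region. -/
theorem mem_region_near_vertex {v : ZMod n → Plane} {j : ZMod n} {ν₁ ν₂ : Plane}
    (hν₁ : ‖ν₁‖ = 1) (hν₂ : ‖ν₂‖ = 1)
    (h₁ : PointsInward v j ν₁) (h₂ : PointsInward v (j + 1) ν₂)
    (hp₁ : inner ℝ (v (j + 1)) ν₁ = inner ℝ (v j) ν₁)
    (hp₂ : inner ℝ (v (j + 1 + 1)) ν₂ = inner ℝ (v (j + 1)) ν₂)
    {U : Set Plane} (hUo : IsOpen U) (hUc : Convex ℝ U)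
    (hU : ∀ k, k ≠ j → k ≠ j + 1 → Disjoint U (edge v k))
    (hU₀ : v j ∉ U) (hU₁ : v (j + 1) ∈ U) (hU₂ : v (j + 1 + 1) ∉ U)
    {y : Plane} (hy : y ∈ U) (hy₁ : inner ℝ (v (j + 1)) ν₁ ≤ inner ℝ y ν₁)
    (hy₂ : inner ℝ (v (j + 1)) ν₂ ≤ inner ℝ y ν₂)
    (heq : inner ℝ (v (j + 1)) ν₁ = inner ℝ y ν₁ → inner ℝ (v (j + 1)) ν₂ = inner ℝ y ν₂ →
      y = v (j + 1)) : y ∈ region v := by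
  set c := v (j + 1) with hc
  have hcurve : ∀ q ∈ U, q ∈ curve v → q ∈ segment ℝ c (v j) ∨ q ∈ segment ℝ c (v (j + 1 + 1)) := by
    intro q hq hqc
    obtain ⟨k, hk⟩ := mem_iUnion.1 hqc
    by_cases hkj : k = j
    · subst hkj; left; rw [segment_symm]; exact hk
    by_cases hkj' : k = j + 1
    · subst hkj'; right; exact hk
    exact absurd hk (Set.disjoint_left.1 (hU k hkj hkj') hq)
  have hcj : v j ≠ c := fun h => hU₀ (h ▸ hU₁)
  have hcj' : v (j + 1 + 1) ≠ c := fun h => hU₂ (h ▸ hU₁)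
  obtain ⟨z₁, hz₁, hzU₁⟩ := exists_mem_openSegment_of_mem hUo (right_mem_segment ℝ (v j) c) hU₁
  obtain ⟨z₂, hz₂, hzU₂⟩ := exists_mem_openSegment_of_mem hUo
    (left_mem_segment ℝ c (v (j + 1 + 1))) hU₁
  have hzν₁ : inner ℝ z₁ ν₁ = inner ℝ c ν₁ := by
    rw [hp₁]; exact inner_eq_of_mem_segment hp₁ (openSegment_subset_segment ℝ _ _ hz₁)
  have hzν₂ : inner ℝ z₂ ν₂ = inner ℝ c ν₂ :=
    inner_eq_of_mem_segment hp₂ (openSegment_subset_segment ℝ _ _ hz₂)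
  rcases hy₁.lt_or_eq with hlt₁ | heq₁
  -- If the next edge does not enter the open inward side of edge j, that side misses the curve
  -- within `U` and already contains y.
  · rcases le_or_gt (inner ℝ (v (j + 1 + 1)) ν₁) (inner ℝ c ν₁) with hb | hb
    · refine mem_region_of_pointsInward hν₁ h₁ hUo hUc hz₁ hzU₁ (fun q hq hzq hqc => ?_) hy
        (by rwa [hzν₁])
      rw [hzν₁] at hzq
      rcases hcurve q hq hqc with h | h
      · exact hzq.not_ge (inner_le_of_mem_segment hp₁.ge h)
      · exact hzq.not_ge (inner_le_of_mem_segment hb h)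
    rcases hy₂.lt_or_eq with hlt₂ | heq₂
    · rcases le_or_gt (inner ℝ (v j) ν₂) (inner ℝ c ν₂) with ha | ha
      · refine mem_region_of_pointsInward hν₂ h₂ hUo hUc hz₂ hzU₂ (fun q hq hzq hqc => ?_) hy
          (by rwa [hzν₂])
        rw [hzν₂] at hzq
        rcases hcurve q hq hqc with h | h
        · exact hzq.not_ge (inner_le_of_mem_segment ha h)
        · exact hzq.not_ge (inner_le_of_mem_segment hp₂.le h)
      -- Each edge enters the open inward side of the other, so neither side alone misses the curve
      -- within `U`; the wedge where both sides meet does.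
      · have hlin : IsLinearMap ℝ fun q : Plane => (inner ℝ q ν₂ : ℝ) :=
          ⟨fun x y => inner_add_left x y ν₂, fun c x => real_inner_smul_left x ν₂ c⟩
        refine mem_region_of_pointsInward hν₁ h₁ (U := U ∩ {q | inner ℝ c ν₂ < inner ℝ q ν₂})
          (hUo.inter (isOpen_lt (by fun_prop) (by fun_prop)))
          (hUc.inter (convex_halfSpace_gt hlin _)) hz₁ ⟨hzU₁, ?_⟩
          (fun q hq hzq hqc => ?_) ⟨hy, hlt₂⟩ (by rwa [hzν₁])
        · obtain ⟨r, s, hr, hs, hrs, rfl⟩ := hz₁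
          simp only [mem_ofPred_eq, inner_add_left, real_inner_smul_left]
          have : s = 1 - r := by linarith
          subst this
          nlinarith
        · rw [hzν₁] at hzq
          rcases hcurve q hq.1 hqc with h | h
          · exact hzq.not_ge (inner_le_of_mem_segment hp₁.ge h)
          · exact (show inner ℝ c ν₂ < inner ℝ q ν₂ from hq.2).not_ge
              (inner_le_of_mem_segment hp₂.le h)
    -- Now y is on the line of the second edge. Both y and the far endpoint are strictly inward of
    -- the first edge, so they lie on the same ray from c.
    · obtain ⟨r, hr⟩ := exists_smul_of_inner_eq_zero (w := y - c) hν₂ (sub_ne_zero.2 hcj')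
        (by rw [inner_sub_left, hp₂, sub_self]) (by rw [inner_sub_left, heq₂, sub_self])
      refine curve_subset_region v (mem_iUnion.2 ⟨j + 1, mem_segment_of_convex hUc ?_ hr hU₁ hy hU₂⟩)
      have := congrArg (fun q : Plane => (inner ℝ q ν₁ : ℝ)) hr
      simp only [inner_sub_left, real_inner_smul_left] at this
      by_contra hneg
      nlinarith
  · rcases hy₂.lt_or_eq with hlt₂ | heq₂
    · rcases le_or_gt (inner ℝ (v j) ν₂) (inner ℝ c ν₂) with ha | ha
      · refine mem_region_of_pointsInward hν₂ h₂ hUo hUc hz₂ hzU₂ (fun q hq hzq hqc => ?_) hy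
          (by rwa [hzν₂])
        rw [hzν₂] at hzq
        rcases hcurve q hq hqc with h | h
        · exact hzq.not_ge (inner_le_of_mem_segment ha h)
        · exact hzq.not_ge (inner_le_of_mem_segment hp₂.le h)
      · obtain ⟨r, hr⟩ := exists_smul_of_inner_eq_zero (w := y - c) hν₁ (sub_ne_zero.2 hcj)
          (by rw [inner_sub_left, ← hp₁, sub_self]) (by rw [inner_sub_left, heq₁, sub_self])
        refine curve_subset_region v (mem_iUnion.2 ⟨j, ?_⟩)
        rw [edge, segment_symm]
        refine mem_segment_of_convex hUc ?_ hr hU₁ hy hU₀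
        have := congrArg (fun q : Plane => (inner ℝ q ν₂ : ℝ)) hr
        simp only [inner_sub_left, real_inner_smul_left] at this
        by_contra hneg
        nlinarith
    -- For parallel edges the two equalities alone would not identify y with the vertex, hence the
    -- hypothesis `heq`.
    · rw [heq heq₁ heq₂]
      exact curve_subset_region v (mem_iUnion.2 ⟨j, right_mem_segment ℝ _ _⟩)

/-! ### Simple polygons -/

theorem IsSimplePolygon.neZero {v : ZMod n → Plane} (h : IsSimplePolygon v) : NeZero n :=
  ⟨by have := h.three_le; omega⟩

theorem IsSimplePolygon.add_one_ne {v : ZMod n → Plane} (h : IsSimplePolygon v) (j : ZMod n) :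
    j + 1 ≠ j := by
  have : Fact (1 < n) := ⟨by have := h.three_le; omega⟩
  simp

theorem IsSimplePolygon.add_two_ne {v : ZMod n → Plane} (h : IsSimplePolygon v) (j : ZMod n) :
    j + 1 + 1 ≠ j := by
  rw [add_assoc, Ne, add_eq_left]
  intro h2
  have h3 : ((2 : ℕ) : ZMod n) = 0 := by rw [← h2]; norm_num
  have := Nat.le_of_dvd two_pos ((ZMod.natCast_eq_zero_iff 2 n).1 h3)
  have := h.three_le
  omega

theorem IsSimplePolygon.notMem_edge_of_ne {v : ZMod n → Plane} (h : IsSimplePolygon v)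
    {j k : ZMod n} {x : Plane} (hx : x ∈ edge v j) (hkj : k ≠ j) (h₀ : x ≠ v j)
    (h₁ : k ≠ j + 1 ∨ x ≠ v (j + 1)) : x ∉ edge v k := by
  intro hxk
  by_cases hk : k = j + 1
  · subst hk
    exact h₁.elim (fun h => h rfl) fun h₁ => h₁ ((h.consecutive j).subset ⟨hx, hxk⟩)
  by_cases hk' : j = k + 1
  · subst hk'
    exact h₀ ((h.consecutive k).subset ⟨hxk, hx⟩)
  · exact Set.disjoint_left.1 (h.nonconsecutive j k hkj hk hk') hx hxk

theorem vertex_mem_edge_sub_one (v : ZMod n → Plane) (j : ZMod n) : v j ∈ edge v (j - 1) := by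
  rw [edge, sub_add_cancel]
  exact right_mem_segment ℝ _ _

/-! ### Moving polygons -/

/-- Adding the parameter of the point on the segment makes this a closed condition; projecting the
compact unit interval away preserves closedness. -/
theorem isClosed_setOf_mem_edge {v : ℝ → ZMod n → Plane} (hv : ∀ j, Continuous fun t => v t j)
    (k : ZMod n) : IsClosed {q : ℝ × Plane | q.2 ∈ edge (v q.1) k} := by
  have hc : IsClosed {q : unitInterval × (ℝ × Plane) |
      q.2.2 = v q.2.1 k + (q.1 : ℝ) • (v q.2.1 (k + 1) - v q.2.1 k)} := by
    have h₀ := (hv k).comp (continuous_fst.comp (continuous_snd (X := unitInterval)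
      (Y := ℝ × Plane)))
    have h₁ := (hv (k + 1)).comp (continuous_fst.comp (continuous_snd (X := unitInterval)
      (Y := ℝ × Plane)))
    exact isClosed_eq (by fun_prop)
      (h₀.add ((continuous_subtype_val.comp continuous_fst).smul (h₁.sub h₀)))
  convert isClosedMap_snd_of_compactSpace _ hc using 1
  ext ⟨t, y⟩
  simp only [edge, segment_eq_image', mem_ofPred_eq, mem_image, Prod.exists]
  constructor
  · rintro ⟨r, hr, h⟩
    exact ⟨⟨r, hr⟩, t, y, h.symm, rfl⟩
  · rintro ⟨r, t', y', h, heq⟩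
    obtain ⟨rfl, rfl⟩ := Prod.mk.inj heq
    exact ⟨r, r.2, h.symm⟩

theorem isClosed_setOf_mem_curve [NeZero n] {v : ℝ → ZMod n → Plane}
    (hv : ∀ j, Continuous fun t => v t j) : IsClosed {q : ℝ × Plane | q.2 ∈ curve (v q.1)} := by
  have : {q : ℝ × Plane | q.2 ∈ curve (v q.1)} = ⋃ k, {q : ℝ × Plane | q.2 ∈ edge (v q.1) k} := by
    ext; simp [curve]
  rw [this]
  exact isClosed_iUnion_of_finite fun k => isClosed_setOf_mem_edge hv k

/-- By closedness, avoiding an edge is an open condition in time and space jointly, so one ball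
works for all nearby times. -/
theorem exists_ball_disjoint_edges [NeZero n] {v : ℝ → ZMod n → Plane}
    (hv : ∀ j, Continuous fun t => v t j) {τ : ℝ} {x : Plane} {P : ZMod n → Prop}
    (hP : ∀ k, P k → x ∉ edge (v τ) k) :
    ∃ ρ > 0, ∀ᶠ t in 𝓝 τ, ∀ k, P k → Disjoint (Metric.ball x ρ) (edge (v t) k) := by
  have h : ∀ᶠ q : ℝ × Plane in 𝓝 τ ×ˢ 𝓝 x, ∀ k, P k → q.2 ∉ edge (v q.1) k := by
    rw [← nhds_prod_eq, eventually_all]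
    intro k
    by_cases hk : P k
    · have := (isClosed_setOf_mem_edge hv k).isOpen_compl.mem_nhds
        (show (τ, x) ∈ {q : ℝ × Plane | q.2 ∈ edge (v q.1) k}ᶜ from hP k hk)
      filter_upwards [this] with q hq _ using hq
    · exact Eventually.of_forall fun q h => absurd h hk
  obtain ⟨p, hp, q, hq, hpq⟩ := eventually_prod_iff.1 h
  obtain ⟨ρ, hρ, hball⟩ := Metric.eventually_nhds_iff_ball.1 hq
  exact ⟨ρ, hρ, hp.mono fun t ht k hk =>
    Set.disjoint_left.2 fun y hy => hpq ht (hball y hy) k hk⟩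

/-- A continuously moving simple polygon. During the time set `I`, its `j`-th edge lies on the line
`⟪x, ν j⟫ = f j t`, which moves in the direction of the inward normal `ν j`, and a vertex is at rest
whenever both incident edges are. -/
structure InwardMotion (v : ℝ → ZMod n → Plane) (ν : ZMod n → Plane) (f : ZMod n → ℝ → ℝ)
    (I : Set ℝ) : Prop where
  continuous : ∀ j, Continuous fun t => v t j
  norm_eq : ∀ j, ‖ν j‖ = 1
  monotone : ∀ j, Monotone (f j)
  simple : ∀ t ∈ I, IsSimplePolygon (v t)
  inward : ∀ t ∈ I, ∀ j, PointsInward (v t) j (ν j)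
  incident_left : ∀ t ∈ I, ∀ j, inner ℝ (v t j) (ν j) = f j t
  incident_right : ∀ t ∈ I, ∀ j, inner ℝ (v t (j + 1)) (ν j) = f j t
  rigid : ∀ t ∈ I, ∀ t' ∈ I, ∀ j, f j t = f j t' → f (j + 1) t = f (j + 1) t' →
    v t (j + 1) = v t' (j + 1)

namespace InwardMotion

variable {v : ℝ → ZMod n → Plane} {ν : ZMod n → Plane} {f : ZMod n → ℝ → ℝ} {I : Set ℝ}

theorem mono (h : InwardMotion v ν f I) {J : Set ℝ} (hJ : J ⊆ I) : InwardMotion v ν f J :=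
  ⟨h.continuous, h.norm_eq, h.monotone, fun t ht => h.simple t (hJ ht),
    fun t ht => h.inward t (hJ ht), fun t ht => h.incident_left t (hJ ht),
    fun t ht => h.incident_right t (hJ ht), fun t ht t' ht' => h.rigid t (hJ ht) t' (hJ ht')⟩

theorem eventually_mem_region_of_vertex (h : InwardMotion v ν f I) {τ : ℝ} (hτ : τ ∈ I)
    (j : ZMod n) : ∀ᶠ t in 𝓝 τ, t ∈ I → t ≤ τ → v τ (j + 1) ∈ region (v t) := by
  have hs := h.simple τ hτ
  have := hs.neZero
  obtain ⟨ρ, hρ, hball⟩ := exists_ball_disjoint_edges h.continuous (τ := τ) (x := v τ (j + 1))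
    (P := fun k => k ≠ j ∧ k ≠ j + 1) fun k hk => hs.notMem_edge_of_ne
      (right_mem_segment ℝ _ _) hk.1 (hs.edge_ne j).symm (Or.inl hk.2)
  filter_upwards [hball, (h.continuous (j + 1)).tendsto τ (Metric.ball_mem_nhds _ hρ)]
    with t ht htv htI htτ
  -- The far endpoints of the two incident edges also lie on edges j - 1 and j + 2. Since there are
  -- at least three edges, these are not the incident ones, so the ball misses them.
  have e₁ : j - 1 ≠ j := fun e => hs.add_one_ne (j - 1) (by rw [sub_add_cancel, e])
  have e₂ : j - 1 ≠ j + 1 := fun e => hs.add_two_ne (j - 1) (by rw [sub_add_cancel, ← e])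
  refine mem_region_near_vertex (h.norm_eq j) (h.norm_eq (j + 1)) (h.inward t htI j)
    (h.inward t htI (j + 1)) (by rw [h.incident_left t htI, h.incident_right t htI])
    (by rw [h.incident_left t htI, h.incident_right t htI]) Metric.isOpen_ball
    (convex_ball (v τ (j + 1)) ρ) (fun k hk hk' => ht k ⟨hk, hk'⟩) ?_ htv ?_
    (Metric.mem_ball_self hρ) ?_ ?_ ?_
  · exact fun hv => Set.disjoint_left.1 (ht (j - 1) ⟨e₁, e₂⟩) hv
      (vertex_mem_edge_sub_one _ j)
  · exact fun hv => Set.disjoint_left.1 (ht (j + 1 + 1) ⟨hs.add_two_ne j, hs.add_one_ne _⟩) hv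
      (left_mem_segment ℝ _ _)
  · rw [h.incident_right t htI, h.incident_right τ hτ]
    exact h.monotone j htτ
  · rw [h.incident_left t htI, h.incident_left τ hτ]
    exact h.monotone (j + 1) htτ
  -- Equality in both inequalities means that neither incident edge moved between t and τ; then
  -- `rigid` says that the vertex did not move either.
  · rw [h.incident_right t htI, h.incident_right τ hτ, h.incident_left t htI,
      h.incident_left τ hτ]
    exact fun h₁ h₂ => (h.rigid t htI τ hτ j h₁ h₂).symm

/-- Every point of the curve belongs to the region slightly earlier. -/
theorem eventually_mem_region (h : InwardMotion v ν f I) {τ : ℝ} (hτ : τ ∈ I) {x : Plane}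
    (hx : x ∈ curve (v τ)) : ∀ᶠ t in 𝓝 τ, t ∈ I → t ≤ τ → x ∈ region (v t) := by
  have hs := h.simple τ hτ
  have := hs.neZero
  obtain ⟨j, hj⟩ := mem_iUnion.1 hx
  by_cases hx₁ : x = v τ (j + 1)
  · rw [hx₁]; exact h.eventually_mem_region_of_vertex hτ j
  by_cases hx₀ : x = v τ j
  · rw [hx₀, ← sub_add_cancel j 1]; exact h.eventually_mem_region_of_vertex hτ (j - 1)
  obtain ⟨ρ, hρ, hball⟩ := exists_ball_disjoint_edges h.continuous (τ := τ) (x := x)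
    (P := fun k => k ≠ j) fun k hk => hs.notMem_edge_of_ne hj hk hx₀ (Or.inr hx₁)
  have hj' := hj
  rw [edge, segment_eq_image'] at hj'
  obtain ⟨r, hr, hrx⟩ := hj'
  simp only at hrx
  -- The point with the same parameter on the moving edge stays close to x and witnesses that the
  -- edge still meets the ball.
  have hcont : Continuous fun t => v t j + r • (v t (j + 1) - v t j) := by
    have h₀ := h.continuous j
    have h₁ := h.continuous (j + 1)
    fun_prop
  have htend := hcont.tendsto τ
  simp only [hrx] at htend
  filter_upwards [hball, htend (Metric.ball_mem_nhds x hρ)] with t ht htc htI htτ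
  have e₁ : j - 1 ≠ j := fun e => hs.add_one_ne (j - 1) (by rw [sub_add_cancel, e])
  have hperp : inner ℝ (v t (j + 1)) (ν j) = inner ℝ (v t j) (ν j) := by
    rw [h.incident_left t htI, h.incident_right t htI]
  have hc : v t j + r • (v t (j + 1) - v t j) ∈ edge (v t) j := by
    rw [edge, segment_eq_image']; exact ⟨r, hr, rfl⟩
  refine mem_region_near_edge (h.norm_eq j) (h.inward t htI j) hperp Metric.isOpen_ball
    (convex_ball x ρ) ht ?_ ?_ hc htc (Metric.mem_ball_self hρ) ?_
  · exact fun hv => Set.disjoint_left.1 (ht (j - 1) e₁) hv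
      (vertex_mem_edge_sub_one _ j)
  · exact fun hv => Set.disjoint_left.1 (ht (j + 1) (hs.add_one_ne _)) hv
      (left_mem_segment ℝ _ _)
  · rw [inner_eq_of_mem_segment hperp hc, inner_eq_of_mem_segment (ν := ν j)
      (by rw [h.incident_left τ hτ, h.incident_right τ hτ]) hj, h.incident_left t htI,
      h.incident_left τ hτ]
    exact h.monotone j htτ

end InwardMotion

theorem isBounded_setOf_mem_curve [NeZero n] {v : ℝ → ZMod n → Plane}
    (hv : ∀ j, Continuous fun t => v t j) (s t : ℝ) :
    ∃ M, ∀ r ∈ Icc s t, ∀ x ∈ curve (v r), ‖x‖ < M := by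
  have h : ∀ j, ∃ M, ∀ r ∈ Icc s t, ‖v r j‖ < M := fun j => by
    obtain ⟨M, hM⟩ := isCompact_Icc.exists_bound_of_continuousOn (s := Icc s t)
      (hv j).continuousOn
    exact ⟨M + 1, fun r hr => (hM r hr).trans_lt (by linarith)⟩
  choose M hM using h
  refine ⟨∑ j, |M j|, fun r hr x hx => ?_⟩
  have hle : ∀ j, ‖v r j‖ < ∑ j, |M j| := fun j => (hM j r hr).trans_le ((le_abs_self _).trans
    (Finset.single_le_sum (f := fun j => |M j|) (fun j _ => abs_nonneg _) (Finset.mem_univ j)))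
  obtain ⟨j, hj⟩ := mem_iUnion.1 hx
  have := (convex_ball (0 : Plane) (∑ j, |M j|)).segment_subset
    (mem_ball_zero_iff.2 (hle j)) (mem_ball_zero_iff.2 (hle (j + 1))) hj
  exact mem_ball_zero_iff.1 this

/-- A connected set avoiding the curve and reaching farther out than the curve contains no point of
the region. -/
theorem notMem_region_of_far {v : ZMod n → Plane} {S : Set Plane} (hS : IsPreconnected S)
    (hSv : Disjoint S (curve v)) {M : ℝ} (hM : ∀ x ∈ curve v, ‖x‖ < M) {z : Plane} (hz : z ∈ S)
    (hz₀ : z ≠ 0) (hzM : M ≤ ‖z‖) {x : Plane} (hx : x ∈ S) : x ∉ region v := by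
  -- The radial ray beyond z stays outside the curve and makes the connected set unbounded.
  have hray : IsPreconnected ((fun r : ℝ => r • z) '' Ici 1) :=
    isPreconnected_Ici.image _ (by fun_prop)
  have hzr : z ∈ (fun r : ℝ => r • z) '' Ici 1 := ⟨1, self_mem_Ici, one_smul ℝ z⟩
  refine notMem_region_of_unbounded (hS.union z hz hzr hray) ?_ ?_ (Or.inl hx)
  · refine Set.disjoint_union_left.2 ⟨hSv, Set.disjoint_left.2 ?_⟩
    rintro _ ⟨r, hr, rfl⟩ hrz
    have h1 := hM _ hrz
    have hr : (1 : ℝ) ≤ r := hr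
    rw [norm_smul, Real.norm_of_nonneg (by linarith)] at h1
    nlinarith [norm_nonneg z]
  · intro hb
    obtain ⟨C, hC⟩ := hb.exists_norm_le
    have hz' : 0 < ‖z‖ := norm_pos_iff.2 hz₀
    have := hC ((max 1 ((|C| + 1) / ‖z‖)) • z)
      (Or.inr (mem_image_of_mem (fun r : ℝ => r • z) (mem_Ici.2 (le_max_left _ _))))
    rw [norm_smul, Real.norm_of_nonneg (by positivity)] at this
    have h2 : |C| + 1 ≤ max 1 ((|C| + 1) / ‖z‖) * ‖z‖ := by
      rw [← div_le_iff₀ hz']; exact le_max_right _ _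
    linarith [le_abs_self C]

/-- The region of a polygon shrinks in the course of an inward motion. -/
theorem InwardMotion.region_subset {v : ℝ → ZMod n → Plane} {ν : ZMod n → Plane}
    {f : ZMod n → ℝ → ℝ} {s t : ℝ} (hst : s ≤ t) (h : InwardMotion v ν f (Icc s t)) :
    region (v t) ⊆ region (v s) := by
  have hs := h.simple s (left_mem_Icc.2 hst)
  have := hs.neZero
  intro x hxt
  by_contra hxs
  obtain ⟨V, hVo, hVp, hxV, hVb, hVd⟩ := exists_unbounded_of_notMem_region hxs
  obtain ⟨M, hM⟩ := isBounded_setOf_mem_curve h.continuous s t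
  obtain ⟨z, hzV, hzM⟩ : ∃ z ∈ V, |M| < ‖z‖ := by
    by_contra! hno
    exact hVb (isBounded_iff_forall_norm_le.2 ⟨_, hno⟩)
  have hz₀ : z ≠ 0 := norm_pos_iff.1 ((abs_nonneg M).trans_lt hzM)
  have hzM := (le_abs_self M).trans hzM.le
  obtain ⟨γ, hγ⟩ := (hVo.isConnected_iff_isPathConnected.1 ⟨⟨x, hxV⟩, hVp⟩).joinedIn x hxV z hzV
  have hΓ : IsCompact (range γ) := isCompact_range γ.continuous
  have hΓp : IsPreconnected (range γ) := isPreconnected_range γ.continuous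
  have hxΓ : x ∈ range γ := ⟨0, γ.source⟩
  have hzΓ : z ∈ range γ := ⟨1, γ.target⟩
  have hΓV : range γ ⊆ V := range_subset_iff.2 hγ
  have hout : ∀ r ∈ Icc s t, Disjoint (range γ) (curve (v r)) → ∀ y ∈ range γ,
      y ∉ region (v r) := fun r hr hd y hy =>
    notMem_region_of_far hΓp hd (hM r hr) hzΓ hz₀ hzM hy
  -- The times at which the curve touches the path form a compact set, so a first contact exists.
  set T := Prod.fst '' ((Icc s t ×ˢ range γ) ∩ {q : ℝ × Plane | q.2 ∈ curve (v q.1)}) with hT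
  have hTc : IsCompact T := ((isCompact_Icc.prod hΓ).inter_right
    (isClosed_setOf_mem_curve h.continuous)).image continuous_fst
  have hTn : T.Nonempty := by
    by_contra hne
    refine hout t (right_mem_Icc.2 hst) (Set.disjoint_left.2 fun y hy hyc => hne ?_) x hxΓ hxt
    exact ⟨t, (t, y), ⟨⟨right_mem_Icc.2 hst, hy⟩, hyc⟩, rfl⟩
  obtain ⟨τ, ⟨⟨_, y⟩, ⟨⟨hτ, hyΓ⟩, hyc⟩, rfl⟩, hmin⟩ := hTc.exists_isLeast hTn
  simp only [mem_ofPred_eq] at hτ hyΓ hyc hmin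
  rename_i τ
  have hsτ : s < τ := by
    refine lt_of_le_of_ne hτ.1 ?_
    rintro rfl
    exact Set.disjoint_left.1 hVd (hΓV hyΓ) (curve_subset_region _ hyc)
  have hev := (h.eventually_mem_region hτ hyc).filter_mono
    (nhdsWithin_le_nhds (s := Iio τ))
  obtain ⟨r, hr, hrτ⟩ := (hev.and (Ioo_mem_nhdsLT hsτ)).exists
  have hrI : r ∈ Icc s t := ⟨hrτ.1.le, hrτ.2.le.trans hτ.2⟩
  -- At a time r just before the first contact, y is in the region by the local lemma but outside it
  -- because the path still misses the curve.
  refine hout r hrI (Set.disjoint_left.2 fun q hq hqc => ?_) y hyΓ (hr hrI hrτ.2.le)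
  exact (hmin ⟨(r, q), ⟨⟨hrI, hq⟩, hqc⟩, rfl⟩).not_gt hrτ.2

/-! ### Normals and offset lines -/

theorem norm_leftNormal {a b : Plane} (h : a ≠ b) : ‖leftNormal a b‖ = 1 := by
  have hn : ‖b - a‖ ≠ 0 := norm_ne_zero_iff.2 (sub_ne_zero.2 h.symm)
  have h1 : ‖(!₂[-(b - a) 1, (b - a) 0] : Plane)‖ = ‖b - a‖ := by
    rw [← sq_eq_sq₀ (norm_nonneg _) (norm_nonneg _), plane_norm_sq, plane_norm_sq]
    simp; ring
  rw [leftNormal, norm_smul, h1, norm_inv, norm_norm, inv_mul_cancel₀ hn]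

theorem inner_sub_leftNormal (a b : Plane) : inner ℝ (b - a) (leftNormal a b) = 0 := by
  rw [leftNormal, real_inner_smul_right, plane_inner_eq]
  simp; right; ring

theorem norm_inwardNormal {p : ZMod n → Plane} {e : ZMod n} (h : p e ≠ p (e + 1)) :
    ‖inwardNormal p e‖ = 1 := by
  unfold inwardNormal
  split_ifs
  · exact norm_leftNormal h
  · rw [norm_neg]; exact norm_leftNormal h

theorem inner_sub_inwardNormal (p : ZMod n → Plane) (e : ZMod n) :
    inner ℝ (p (e + 1) - p e) (inwardNormal p e) = 0 := by
  unfold inwardNormal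
  split_ifs
  · exact inner_sub_leftNormal _ _
  · rw [inner_neg_right, inner_sub_leftNormal, neg_zero]

theorem continuous_offset (δ : ZMod n → ℝ) (e : ZMod n) : Continuous (offset δ e) := by
  unfold offset; fun_prop

theorem monotone_offset (δ : ZMod n → ℝ) (e : ZMod n) : Monotone (offset δ e) :=
  fun _ _ h => max_le_max le_rfl (sub_le_sub_right h _)

/-- The signed distance of the offset line of the edge `e` from the origin. -/
def level (p : ZMod n → Plane) (δ : ZMod n → ℝ) (e : ZMod n) (t : ℝ) : ℝ :=
  inner ℝ (p e) (inwardNormal p e) + offset δ e t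

theorem inner_eq_level {p : ZMod n → Plane} {δ : ZMod n → ℝ} {e : ZMod n} {t : ℝ}
    (he : p e ≠ p (e + 1)) {y : Plane} (hy : y ∈ offsetLine p δ e t) :
    inner ℝ y (inwardNormal p e) = level p δ e t := by
  obtain ⟨y₀, hy₀, rfl⟩ := hy
  rw [← vsub_vadd y₀ (p e), SetLike.mem_coe, vadd_left_mem_affineSpan_pair] at hy₀
  obtain ⟨r, hr⟩ := hy₀
  simp only [vsub_eq_sub] at hr
  obtain rfl : y₀ = r • (p (e + 1) - p e) + p e := by rw [hr, sub_add_cancel]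
  simp only [level, inner_add_left, real_inner_smul_left,
    inner_sub_inwardNormal, real_inner_self_eq_norm_sq, norm_inwardNormal he]
  ring

theorem eq_or_eq_neg_of_det_eq_zero {a b : Plane} (ha : ‖a‖ = 1) (hb : ‖b‖ = 1)
    (h : a 0 * b 1 - a 1 * b 0 = 0) : b = a ∨ b = -a := by
  have ha2 := plane_norm_sq a
  have hb2 := plane_norm_sq b
  rw [ha] at ha2
  rw [hb] at hb2
  set d := a 0 * b 0 + a 1 * b 1 with hd
  have h0 : b 0 = d * a 0 := by linear_combination b 0 * ha2 - a 1 * h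
  have h1 : b 1 = d * a 1 := by linear_combination b 1 * ha2 + a 0 * h
  have hd2 : (d - 1) * (d + 1) = 0 := by
    rw [h0, h1] at hb2
    linear_combination d ^ 2 * ha2 - hb2
  rcases mul_eq_zero.1 hd2 with h' | h'
  · left
    have : d = 1 := by linarith
    exact plane_ext (by rw [h0, this, one_mul]) (by rw [h1, this, one_mul])
  · right
    have : d = -1 := by linarith
    exact plane_ext (by rw [h0, this]; simp) (by rw [h1, this]; simp)

/-- Cramer's rule: a vertex with nonparallel incident edges is a fixed linear function of their two
levels, hence continuous in time. -/
theorem eq_of_inner_eq {a b x : Plane} (h : a 0 * b 1 - a 1 * b 0 ≠ 0) :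
    x = (inner ℝ x a : ℝ) • (a 0 * b 1 - a 1 * b 0)⁻¹ • !₂[b 1, -b 0] +
      (inner ℝ x b : ℝ) • (a 0 * b 1 - a 1 * b 0)⁻¹ • !₂[-a 1, a 0] := by
  rw [plane_inner_eq, plane_inner_eq]
  refine plane_ext ?_ ?_
  · simp; field_simp; ring
  · simp; field_simp; ring

/-! ### The motion between two events -/

namespace MovingPolygon.MovesBetween

variable {K : MovingPolygon (ZMod n)} {p : ZMod n → Plane} {δ : ZMod n → ℝ} {a b : ℝ}

/-- `K.vertex` is unconstrained outside `Icc a b`, so it is replaced by an explicit function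
continuous on all of ℝ: Cramer's rule if the incident edges are not parallel, the `tangential`
formula if they are. Either formula depends on time only through the two offsets, which gives
rigidity. -/
theorem exists_continuous_vertex (h : K.MovesBetween p δ a b) (hp : IsSimplePolygon p)
    (j : ZMod K.size) : ∃ g : ℝ → Plane, Continuous g ∧
      (∀ t ∈ Icc a b, K.vertex t (j + 1) = g t) ∧
      ∀ t t', offset δ (K.label j) t = offset δ (K.label j) t' →
        offset δ (K.label (j + 1)) t = offset δ (K.label (j + 1)) t' → g t = g t' := by
  set ν₁ := inwardNormal p (K.label j) with hν₁
  set ν₂ := inwardNormal p (K.label (j + 1)) with hν₂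
  have c₁ := continuous_offset δ (K.label j)
  have c₂ := continuous_offset δ (K.label (j + 1))
  by_cases hdet : ν₁ 0 * ν₂ 1 - ν₁ 1 * ν₂ 0 = 0
  · refine ⟨fun t => K.vertex a (j + 1) +
      (offset δ (K.label j) t - offset δ (K.label j) a) • ν₁, by fun_prop,
      h.tangential j (eq_or_eq_neg_of_det_eq_zero (norm_inwardNormal (hp.edge_ne _))
        (norm_inwardNormal (hp.edge_ne _)) hdet), fun t t' e₁ _ => by simp only [e₁]⟩
  · refine ⟨fun t => level p δ (K.label j) t • (ν₁ 0 * ν₂ 1 - ν₁ 1 * ν₂ 0)⁻¹ • !₂[ν₂ 1, -ν₂ 0] +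
      level p δ (K.label (j + 1)) t • (ν₁ 0 * ν₂ 1 - ν₁ 1 * ν₂ 0)⁻¹ • !₂[-ν₁ 1, ν₁ 0], ?_, ?_, ?_⟩
    · unfold level; fun_prop
    · intro t ht
      beta_reduce
      rw [← inner_eq_level (hp.edge_ne _) (h.incident t ht j).2,
        ← inner_eq_level (hp.edge_ne _) (h.incident t ht (j + 1)).1]
      exact eq_of_inner_eq hdet
    · intro t t' e₁ e₂
      simp only [level, e₁, e₂]

theorem exists_inwardMotion (h : K.MovesBetween p δ a b) (hp : IsSimplePolygon p) :
    ∃ u : ℝ → ZMod K.size → Plane, (∀ t ∈ Icc a b, u t = K.vertex t) ∧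
      InwardMotion u (fun j => inwardNormal p (K.label j)) (fun j => level p δ (K.label j))
        (Ico a b) := by
  choose g hgc hg hgr using h.exists_continuous_vertex hp
  have hu : ∀ t ∈ Icc a b, (fun j => g (j - 1) t) = K.vertex t := fun t ht => by
    funext j
    rw [← hg (j - 1) t ht, sub_add_cancel]
  have hu' : ∀ t ∈ Ico a b, (fun j => g (j - 1) t) = K.vertex t := fun t ht =>
    hu t (Ico_subset_Icc_self ht)
  refine ⟨fun t j => g (j - 1) t, hu, fun j => hgc _, fun j => norm_inwardNormal (hp.edge_ne _),
    fun j => (monotone_offset δ _).const_add _, fun t ht => ?_, fun t ht => ?_, fun t ht => ?_,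
    fun t ht => ?_, fun t ht t' ht' j e₁ e₂ => ?_⟩
  · simp only [hu' t ht]; exact (h.planar t (Or.inr ht)).1
  · simp only [hu' t ht]; exact (h.planar t (Or.inr ht)).2
  · intro j
    rw [congrFun (hu' t ht) j]
    exact inner_eq_level (hp.edge_ne _) (h.incident t (Ico_subset_Icc_self ht) j).1
  · intro j
    rw [congrFun (hu' t ht) (j + 1)]
    exact inner_eq_level (hp.edge_ne _) (h.incident t (Ico_subset_Icc_self ht) j).2
  · simp only [add_sub_cancel_right]
    exact hgr j t t' (add_left_cancel e₁) (add_left_cancel e₂)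

theorem region_subset (h : K.MovesBetween p δ a b) (hp : IsSimplePolygon p) {s t : ℝ}
    (has : a ≤ s) (hst : s ≤ t) (htb : t < b) : region (K.vertex t) ⊆ region (K.vertex s) := by
  obtain ⟨u, hu, hm⟩ := h.exists_inwardMotion hp
  rw [← hu t ⟨has.trans hst, htb.le⟩, ← hu s ⟨has, hst.trans htb.le⟩]
  exact InwardMotion.region_subset hst (hm.mono (Icc_subset_Ico has htb))

/-- At time b the polygon may be degenerate, so only its curve is compared: each of its points is
the limit of points with the same edge parameter, which lie in the closed region at time s. -/
theorem curve_subset (h : K.MovesBetween p δ a b) (hp : IsSimplePolygon p) (hab : a ≤ b) {s : ℝ}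
    (hs : s = a ∨ a ≤ s ∧ s < b) : curve (K.vertex b) ⊆ region (K.vertex s) := by
  have := (h.planar a (Or.inl rfl)).1.neZero
  by_cases hsb : s = b
  · rw [hsb]; exact curve_subset_region _
  have has : a ≤ s := hs.elim (fun h => h.ge) And.left
  have hsb : s < b := by
    rcases hs with rfl | hs
    · exact lt_of_le_of_ne hab hsb
    · exact hs.2
  obtain ⟨u, hu, hm⟩ := h.exists_inwardMotion hp
  intro y hy
  obtain ⟨j, hj⟩ := mem_iUnion.1 hy
  rw [edge, segment_eq_image', ← hu b (right_mem_Icc.2 hab)] at hj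
  obtain ⟨r, hr, rfl⟩ := hj
  have hc : Continuous fun t => u t j + r • (u t (j + 1) - u t j) := by
    have h₀ := hm.continuous j
    have h₁ := hm.continuous (j + 1)
    fun_prop
  refine (isClosed_region _).mem_of_tendsto ((hc.tendsto b).mono_left
    (nhdsWithin_le_nhds (s := Iio b))) ?_
  filter_upwards [Ioo_mem_nhdsLT hsb] with t ht
  refine h.region_subset hp has ht.1.le ht.2 (curve_subset_region _ (mem_iUnion.2 ⟨j, ?_⟩))
  rw [edge, segment_eq_image', ← hu t ⟨has.trans ht.1.le, ht.2.le⟩]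
  exact ⟨r, hr, rfl⟩

end MovingPolygon.MovesBetween

/-! ### Events -/

theorem segment_subset_closure_diff_finite {a b : Plane} (hab : a ≠ b) {F : Set Plane}
    (hF : F.Finite) : segment ℝ a b ⊆ closure (segment ℝ a b \ F) := by
  have hF' : (AffineMap.lineMap a b ⁻¹' F : Set ℝ).Finite :=
    hF.preimage (AffineMap.lineMap_injective ℝ hab).injOn
  have hd := (dense_univ (X := ℝ)).sdiff_finite hF'
  have h1 : Icc (0 : ℝ) 1 ⊆ closure (Ioo 0 1 ∩ (univ \ AffineMap.lineMap a b ⁻¹' F)) := by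
    rw [← closure_Ioo zero_ne_one, inter_comm]
    exact closure_minimal ((hd.open_subset_closure_inter isOpen_Ioo).trans
      (by rw [inter_comm])) isClosed_closure
  rw [segment_eq_image_lineMap]
  refine (image_mono h1).trans ((image_closure_subset_closure_image
    AffineMap.lineMap_continuous).trans (closure_mono ?_))
  rintro _ ⟨r, hr, rfl⟩
  exact ⟨⟨r, Ioo_subset_Icc_self hr.1, rfl⟩, hr.2.2⟩

theorem Resolves.curve_subset {p : ZMod n → Plane} {δ : ZMod n → ℝ} {t : ℝ}
    {K : MovingPolygon (ZMod n)} {L : List (MovingPolygon (ZMod n))} (h : Resolves p δ t K L)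
    [NeZero K.size] {K' : MovingPolygon (ZMod n)} (hK' : K' ∈ L)
    (hs : IsSimplePolygon (K'.vertex t)) : curve (K'.vertex t) ⊆ curve (K.vertex t) := by
  refine iUnion_subset fun j => (segment_subset_closure_diff_finite (hs.edge_ne j)
    (h.boundary (K'.label j))).trans (closure_minimal ?_ (isClosed_curve _))
  rintro x ⟨hx, hxF⟩
  by_contra hxc
  -- A point of a new edge off the old curve would belong to the symmetric difference, the finite
  -- set already removed.
  refine hxF (Or.inl ⟨?_, fun hxK => ?_⟩)
  · simp only [mem_iUnion, fragments]
    exact ⟨K', hK', K'.label j, rfl, j, rfl, hx⟩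
  · have := hxK.1
    simp only [mem_iUnion, fragments] at this
    obtain ⟨e', -, i, -, hi⟩ := this
    exact hxc (mem_iUnion.2 ⟨i, hi⟩)

/-! ### Nested wavefronts -/

namespace Propagation

variable {p : ZMod n → Plane} {δ : ZMod n → ℝ}

/-- A point of the wavefront just after an event belongs to the wavefront before the event. -/
theorem exists_mem_region_of_succ (W : Propagation p δ) (hp : IsSimplePolygon p) {i : ℕ}
    (hi : i + 1 < W.N) {K' : MovingPolygon (ZMod n)} (hK' : K' ∈ W.polygons (i + 1)) {s : ℝ}
    (hs : s = W.time i ∨ W.time i ≤ s ∧ s < W.time (i + 1)) :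
    ∃ K ∈ W.polygons i, region (K'.vertex (W.time (i + 1))) ⊆ region (K.vertex s) := by
  obtain ⟨f, hf, hL⟩ := W.event i (by omega)
  have hsimple := ((W.moves (i + 1) hi K' hK').planar _ (Or.inl rfl)).1
  rw [hL, List.mem_flatMap] at hK'
  obtain ⟨K, hK, hK'⟩ := hK'
  have hm := W.moves i (by omega) K hK
  have := (hm.planar _ (Or.inl rfl)).1.neZero
  exact ⟨K, hK, region_subset_region (((hf K hK).curve_subset hK' hsimple).trans
    (hm.curve_subset hp (W.time_le i (by omega)) hs))⟩

theorem exists_mem_region_of_le (W : Propagation p δ) (hp : IsSimplePolygon p) {i k : ℕ}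
    (hik : i ≤ k) (hk : k < W.N) {K' : MovingPolygon (ZMod n)} (hK' : K' ∈ W.polygons k) :
    ∃ K ∈ W.polygons i, region (K'.vertex (W.time k)) ⊆ region (K.vertex (W.time i)) := by
  induction k, hik using Nat.le_induction generalizing K' with
  | base => exact ⟨K', hK', le_rfl⟩
  | succ k _ ih =>
    obtain ⟨K₁, hK₁, h₁⟩ := W.exists_mem_region_of_succ hp hk hK' (Or.inl rfl)
    obtain ⟨K, hK, h⟩ := ih (by omega) hK₁
    exact ⟨K, hK, h₁.trans h⟩

theorem wavefront_subset (W : Propagation p δ) (hp : IsSimplePolygon p) {t₁ t₂ : ℝ}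
    (h₁ : 0 ≤ t₁) (h₁₂ : t₁ ≤ t₂) : W.wavefront t₂ ⊆ W.wavefront t₁ := by
  rintro x ⟨k, hk, hkt, htk, K', hK', hx⟩
  classical
  have hex : W.time 0 ≤ t₁ := by rwa [W.time_zero]
  -- The last stage up to k that has begun by time t₁; if it is not k, then the next stage begins
  -- after t₁, so t₁ falls within stage i.
  set i := Nat.findGreatest (fun i => W.time i ≤ t₁) k with hi
  have hik : i ≤ k := Nat.findGreatest_le k
  have hit : W.time i ≤ t₁ := Nat.findGreatest_spec (P := fun i => W.time i ≤ t₁) (Nat.zero_le k) hex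
  have hm := W.moves k hk K' hK'
  rcases hik.eq_or_lt with hik | hik
  · rw [hik] at hit
    exact ⟨k, hk, hit, h₁₂.trans_lt htk, K', hK', hm.region_subset hp hit h₁₂ htk hx⟩
  · have hit' : t₁ < W.time (i + 1) := not_le.1
      (Nat.findGreatest_is_greatest (P := fun i => W.time i ≤ t₁) (Nat.lt_succ_self i) hik)
    obtain ⟨K₁, hK₁, hsub⟩ := W.exists_mem_region_of_le hp (i := i + 1) hik hk hK'
    obtain ⟨K, hK, hsub'⟩ := W.exists_mem_region_of_succ hp (by omega) hK₁ (Or.inr ⟨hit, hit'⟩)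
    exact ⟨i, by omega, hit, hit', K, hK,
      hsub' (hsub (hm.region_subset hp le_rfl hkt htk hx))⟩

end Propagation

/-! ### A triangle that waits before it shrinks -/

/-- The triangle with incenter `(1, 1)`, inradius `μ` and edge lengths `4 * μ`, `5 * μ`, `3 * μ`. -/
def triangle (μ : ℝ) : ZMod 3 → Plane :=
  (![!₂[1 - μ, 1 - μ], !₂[1 + 3 * μ, 1 - μ], !₂[1 - μ, 1 + 2 * μ]] : Fin 3 → Plane)

/-- The inward unit normals of the triangles `triangle μ`. -/
def triangleNormal : ZMod 3 → Plane :=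
  (![!₂[0, 1], !₂[-(3 / 5), -(4 / 5)], !₂[1, 0]] : Fin 3 → Plane)

/-- The signed distance from the line through the incenter that is parallel to an edge. -/
def triangleHeight (i : ZMod 3) (q : Plane) : ℝ :=
  (q 0 - 1) * triangleNormal i 0 + (q 1 - 1) * triangleNormal i 1

theorem forall_zmod_three {P : ZMod 3 → Prop} : (∀ i, P i) ↔ P 0 ∧ P 1 ∧ P 2 := by
  refine ⟨fun h => ⟨h 0, h 1, h 2⟩, fun ⟨h₀, h₁, h₂⟩ i => ?_⟩
  change Fin 3 at i
  fin_cases i <;> assumption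

theorem zmod_three_add : (0 : ZMod 3) + 1 = 1 ∧ (1 : ZMod 3) + 1 = 2 ∧ (2 : ZMod 3) + 1 = 0 := by
  decide

theorem triangle_zero (μ : ℝ) : triangle μ 0 = !₂[1 - μ, 1 - μ] := rfl
theorem triangle_one (μ : ℝ) : triangle μ 1 = !₂[1 + 3 * μ, 1 - μ] := rfl
theorem triangle_two (μ : ℝ) : triangle μ 2 = !₂[1 - μ, 1 + 2 * μ] := rfl
theorem triangleNormal_zero : triangleNormal 0 = !₂[0, 1] := rfl
theorem triangleNormal_one : triangleNormal 1 = !₂[-(3 / 5), -(4 / 5)] := rfl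
theorem triangleNormal_two : triangleNormal 2 = !₂[1, 0] := rfl

theorem triangleHeight_zero (q : Plane) : triangleHeight 0 q = q 1 - 1 := by
  simp [triangleHeight, triangleNormal_zero]

theorem triangleHeight_one (q : Plane) :
    triangleHeight 1 q = -(3 / 5) * (q 0 - 1) - 4 / 5 * (q 1 - 1) := by
  simp [triangleHeight, triangleNormal_one]; ring

theorem triangleHeight_two (q : Plane) : triangleHeight 2 q = q 0 - 1 := by
  simp [triangleHeight, triangleNormal_two]

/-- Describing edges by linear inequalities reduces the geometry of the triangle to linear
arithmetic in the three heights. -/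
theorem mem_edge_triangle {μ : ℝ} (hμ : 0 < μ) (i : ZMod 3) (q : Plane) :
    q ∈ edge (triangle μ) i ↔ triangleHeight i q = -μ ∧ ∀ k, -μ ≤ triangleHeight k q := by
  obtain ⟨e₀, e₁, e₂⟩ := zmod_three_add
  simp only [forall_zmod_three (P := fun k => -μ ≤ triangleHeight k q), triangleHeight_zero,
    triangleHeight_one, triangleHeight_two, edge, segment_eq_image', mem_image]
  revert i
  rw [forall_zmod_three]
  simp only [e₀, e₁, e₂, triangle_zero, triangle_one, triangle_two, triangleHeight_zero,
    triangleHeight_one, triangleHeight_two]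
  refine ⟨⟨?_, ?_⟩, ⟨?_, ?_⟩, ⟨?_, ?_⟩⟩
  · rintro ⟨r, ⟨h0, h1⟩, rfl⟩
    simp
    refine ⟨?_, ?_⟩ <;> nlinarith
  · rintro ⟨h, h0, h1, h2⟩
    refine ⟨(q 0 - 1 + μ) / (4 * μ), ⟨by apply div_nonneg <;> linarith,
      (div_le_one (by positivity)).2 (by linarith)⟩, plane_ext ?_ ?_⟩
    · simp; field_simp; ring
    · simp; linarith
  · rintro ⟨r, ⟨h0, h1⟩, rfl⟩
    simp
    refine ⟨?_, ?_, ?_, ?_⟩ <;> nlinarith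
  · rintro ⟨h, h0, h1, h2⟩
    refine ⟨(q 1 - 1 + μ) / (3 * μ), ⟨by apply div_nonneg <;> linarith,
      (div_le_one (by positivity)).2 (by linarith)⟩, plane_ext ?_ ?_⟩
    · simp; field_simp; linear_combination 5 * μ * h
    · simp; field_simp; ring
  · rintro ⟨r, ⟨h0, h1⟩, rfl⟩
    simp
    refine ⟨?_, ?_⟩ <;> nlinarith
  · rintro ⟨h, h0, h1, h2⟩
    refine ⟨(1 + 2 * μ - q 1) / (3 * μ), ⟨by apply div_nonneg <;> linarith,
      (div_le_one (by positivity)).2 (by linarith)⟩, plane_ext ?_ ?_⟩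
    · simp; linarith
    · simp; field_simp; ring

theorem isSimplePolygon_triangle {μ : ℝ} (hμ : 0 < μ) : IsSimplePolygon (triangle μ) := by
  obtain ⟨e₀, e₁, e₂⟩ := zmod_three_add
  refine ⟨le_rfl, ?_, ?_, ?_⟩
  · rw [forall_zmod_three, e₀, e₁, e₂]
    refine ⟨fun h => ?_, fun h => ?_, fun h => ?_⟩
    · have := congrArg (fun q : Plane => q 0) h
      simp [triangle_zero, triangle_one] at this; linarith
    · have := congrArg (fun q : Plane => q 1) h
      simp [triangle_two, triangle_one] at this; linarith
    · have := congrArg (fun q : Plane => q 1) h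
      simp [triangle_two, triangle_zero] at this; linarith
  · intro i
    refine Subset.antisymm ?_ ?_
    · rintro q ⟨hq, hq'⟩
      have h := ((mem_edge_triangle hμ _ _).1 hq).1
      have h' := ((mem_edge_triangle hμ _ _).1 hq').1
      clear hq hq'
      revert h h' i
      rw [forall_zmod_three, e₀, e₁, e₂]
      simp only [triangleHeight_zero, triangleHeight_one, triangleHeight_two, mem_singleton_iff]
      refine ⟨fun h h' => plane_ext ?_ ?_, fun h h' => plane_ext ?_ ?_,
        fun h h' => plane_ext ?_ ?_⟩ <;>
      simp [triangle_zero, triangle_one, triangle_two] <;> linarith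
    · rintro q rfl
      exact ⟨right_mem_segment ℝ _ _, left_mem_segment ℝ _ _⟩
  · have : ∀ i j : ZMod 3, j ≠ i → j ≠ i + 1 → i ≠ j + 1 → False := by decide
    exact fun i j h₁ h₂ h₃ => (this i j h₁ h₂ h₃).elim

theorem continuous_triangleHeight (i : ZMod 3) : Continuous (triangleHeight i) := by
  unfold triangleHeight; fun_prop

/-- Off the curve, either all heights exceed -μ or some height is below -μ. These are disjoint open
conditions, so the component of q stays in the bounded open triangle. -/
theorem mem_region_triangle {μ : ℝ} (hμ : 0 < μ) {q : Plane}
    (hq : ∀ k, -μ < triangleHeight k q) : q ∈ region (triangle μ) := by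
  have hcurve : ∀ x, x ∉ curve (triangle μ) → (∀ k, -μ < triangleHeight k x) ∨
      ∃ k, triangleHeight k x < -μ := by
    intro x hx
    by_contra! h
    obtain ⟨⟨k, hk⟩, h⟩ := h
    exact hx (mem_iUnion.2 ⟨k, (mem_edge_triangle hμ k x).2 ⟨le_antisymm hk (h k), h⟩⟩)
  have hqc : q ∉ curve (triangle μ) := by
    intro h
    obtain ⟨k, hk⟩ := mem_iUnion.1 h
    exact (hq k).ne' ((mem_edge_triangle hμ k q).1 hk).1
  have hI : IsOpen {x | ∀ k, -μ < triangleHeight k x} := by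
    simp only [ofPred_forall]
    exact isOpen_iInter_of_finite fun k => isOpen_lt continuous_const (continuous_triangleHeight k)
  have hE : IsOpen {x | ∃ k, triangleHeight k x < -μ} := by
    simp only [ofPred_exists]
    exact isOpen_iUnion fun k => isOpen_lt (continuous_triangleHeight k) continuous_const
  have hsub := isPreconnected_connectedComponentIn.subset_left_of_subset_union hI hE
    (Set.disjoint_left.2 fun x hx ⟨k, hk⟩ => (hx k).not_gt hk)
    (fun x hx => hcurve x (connectedComponentIn_subset _ _ hx))
    ⟨q, mem_connectedComponentIn hqc, hq⟩
  refine Or.inr ⟨hqc, (isBounded_iff_forall_norm_le.2 ⟨2 * (1 + 3 * μ), fun x hx => ?_⟩).subset hsub⟩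
  have hx' := forall_zmod_three.1 hx
  simp only [triangleHeight_zero, triangleHeight_one, triangleHeight_two] at hx'
  obtain ⟨h₀, h₁, h₂⟩ := hx'
  refine le_of_sq_le_sq ?_ (by positivity)
  rw [plane_norm_sq]
  have a₀ : x 0 ^ 2 ≤ (1 + 3 * μ) ^ 2 := sq_le_sq' (by linarith) (by linarith)
  have a₁ : x 1 ^ 2 ≤ (1 + 3 * μ) ^ 2 := sq_le_sq' (by linarith) (by linarith)
  nlinarith

theorem pointsInward_triangle {μ : ℝ} (hμ : 0 < μ) (i : ZMod 3) :
    PointsInward (triangle μ) i (triangleNormal i) := by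
  intro x hx
  obtain ⟨e₀, e₁, e₂⟩ := zmod_three_add
  have hk : ∀ k, -μ < triangleHeight k x ∨ k = i := by
    obtain ⟨r, s, hr, hs, hrs, rfl⟩ := hx
    obtain rfl : r = 1 - s := by linarith
    have h₁ := mul_pos hr hμ
    have h₂ := mul_pos hs hμ
    revert i
    simp only [forall_zmod_three, triangleHeight_zero, triangleHeight_one, triangleHeight_two,
      e₀, e₁, e₂, triangle_zero, triangle_one, triangle_two]
    refine ⟨⟨Or.inr trivial, Or.inl ?_, Or.inl ?_⟩, ⟨Or.inl ?_, Or.inr trivial, Or.inl ?_⟩,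
      ⟨Or.inl ?_, Or.inl ?_, Or.inr trivial⟩⟩ <;> simp <;> nlinarith
  have hi : triangleHeight i x = -μ :=
    ((mem_edge_triangle hμ i x).1 (openSegment_subset_segment ℝ _ _ hx)).1
  have hone : triangleNormal i 0 ^ 2 + triangleNormal i 1 ^ 2 = 1 := by
    revert i
    simp only [forall_zmod_three, triangleNormal_zero, triangleNormal_one, triangleNormal_two]
    refine ⟨?_, ?_, ?_⟩ <;> norm_num
  have hall : ∀ k, ∀ᶠ ε in 𝓝[>] (0 : ℝ), -μ < triangleHeight k (x + ε • triangleNormal i) := by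
    intro k
    rcases hk k with h | rfl
    · have hc : Continuous fun ε : ℝ => triangleHeight k (x + ε • triangleNormal i) :=
        (continuous_triangleHeight k).comp (by fun_prop)
      have := hc.tendsto 0
      simp only [zero_smul, add_zero] at this
      exact (this.mono_left nhdsWithin_le_nhds).eventually (lt_mem_nhds h)
    · filter_upwards [self_mem_nhdsWithin] with ε hε
      have : triangleHeight k (x + ε • triangleNormal k) = triangleHeight k x + ε := by
        simp only [triangleHeight, PiLp.add_apply, PiLp.smul_apply, smul_eq_mul]
        linear_combination ε * hone
      rw [this, hi]
      linarith [mem_Ioi.1 hε]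
  filter_upwards [eventually_all.2 hall] with ε hε
  exact mem_region_triangle hμ hε

theorem leftNormal_eq {a b ν : Plane} {l : ℝ} (hl : 0 < l) (hν : ‖ν‖ = 1) (h₀ : (b - a) 0 = l * ν 1)
    (h₁ : (b - a) 1 = -(l * ν 0)) : leftNormal a b = ν := by
  have hn : ‖b - a‖ = l := by
    have h := plane_norm_sq ν
    rw [hν] at h
    rw [← sq_eq_sq₀ (norm_nonneg _) hl.le, plane_norm_sq, h₀, h₁]
    linear_combination -l ^ 2 * h
  rw [leftNormal, hn, h₀, h₁]
  refine plane_ext ?_ ?_ <;> simp [hl.ne']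

theorem inwardNormal_triangle (i : ZMod 3) : inwardNormal (triangle 1) i = triangleNormal i := by
  have h : leftNormal (triangle 1 i) (triangle 1 (i + 1)) = triangleNormal i := by
    have hn : ∀ i, ‖triangleNormal i‖ = 1 := by
      have : ∀ i, ‖triangleNormal i‖ ^ 2 = 1 ^ 2 := by
        simp only [forall_zmod_three, triangleNormal_zero, triangleNormal_one, triangleNormal_two,
          plane_norm_sq]
        refine ⟨?_, ?_, ?_⟩ <;> norm_num
      exact fun i => (sq_eq_sq₀ (norm_nonneg _) zero_le_one).1 (this i)
    obtain ⟨e₀, e₁, e₂⟩ := zmod_three_add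
    revert i
    rw [forall_zmod_three, e₀, e₁, e₂]
    refine ⟨leftNormal_eq (l := 4) (by norm_num) (hn 0) ?_ ?_,
      leftNormal_eq (l := 5) (by norm_num) (hn 1) ?_ ?_,
      leftNormal_eq (l := 3) (by norm_num) (hn 2) ?_ ?_⟩ <;>
    norm_num [triangle_zero, triangle_one, triangle_two, triangleNormal_zero, triangleNormal_one,
      triangleNormal_two]
  rw [inwardNormal, h, if_pos (pointsInward_triangle one_pos i)]

/-- The wavefront polygon that waits until time `1` and then shrinks to the incenter. -/
def shrinkingTriangle : MovingPolygon (ZMod 3) := ⟨3, id, fun t => triangle (1 - max 0 (t - 1))⟩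

theorem shrinkingTriangle_vertex_of_le {t : ℝ} (ht : t ≤ 1) :
    shrinkingTriangle.vertex t = triangle 1 := by
  change triangle (1 - max 0 (t - 1)) = triangle 1
  rw [max_eq_left (by linarith), sub_zero]

theorem triangle_mem_offsetLine (t : ℝ) (i : ZMod 3) :
    triangle (1 - max 0 (t - 1)) i ∈ offsetLine (triangle 1) (fun _ => 1) i t ∧
    triangle (1 - max 0 (t - 1)) (i + 1) ∈ offsetLine (triangle 1) (fun _ => 1) i t := by
  have key : ∀ (y : Plane) (r : ℝ), y = AffineMap.lineMap (triangle 1 i) (triangle 1 (i + 1)) r +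
      max 0 (t - 1) • triangleNormal i → y ∈ offsetLine (triangle 1) (fun _ => 1) i t := by
    rintro y r rfl
    refine ⟨_, AffineMap.lineMap_mem_affineSpan_pair r _ _, ?_⟩
    simp only [inwardNormal_triangle, offset]
  generalize max 0 (t - 1) = s at key ⊢
  obtain ⟨e₀, e₁, e₂⟩ := zmod_three_add
  revert i
  simp only [forall_zmod_three, e₀, e₁, e₂, AffineMap.lineMap_apply_module', triangle_zero,
    triangle_one, triangle_two, triangleNormal_zero, triangleNormal_one, triangleNormal_two]
  -- The parameters locate the feet of the perpendiculars from the moved vertices to the original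
  -- edges, of lengths 4, 5 and 3.
  refine ⟨fun key => ⟨key _ (s / 4) ?_, key _ ((4 - 3 * s) / 4) ?_⟩,
    fun key => ⟨key _ (3 * s / 5) ?_, key _ (1 - 2 * s / 5) ?_⟩,
    fun key => ⟨key _ (2 * s / 3) ?_, key _ (1 - s / 3) ?_⟩⟩ <;>
  refine plane_ext ?_ ?_ <;> simp <;> ring

theorem movesBetween_shrinkingTriangle :
    shrinkingTriangle.MovesBetween (triangle 1) (fun _ => 1) 0 2 := by
  refine ⟨fun t ht => ?_, fun t _ j => triangle_mem_offsetLine t j, ?_⟩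
  · have hμ : 0 < 1 - max 0 (t - 1) := by
      rw [sub_pos, max_lt_iff]
      rcases ht with rfl | ht
      · norm_num
      · exact ⟨one_pos, by linarith [ht.2]⟩
    refine ⟨isSimplePolygon_triangle hμ, fun j => ?_⟩
    rw [inwardNormal_triangle]
    exact pointsInward_triangle hμ j
  · have hne : ∀ j, ¬ (triangleNormal (j + 1) = triangleNormal j ∨
        triangleNormal (j + 1) = -triangleNormal j) := by
      obtain ⟨e₀, e₁, e₂⟩ := zmod_three_add
      rw [forall_zmod_three, e₀, e₁, e₂, triangleNormal_zero, triangleNormal_one,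
        triangleNormal_two]
      refine ⟨?_, ?_, ?_⟩ <;> rintro (h | h) <;>
      · have h0 := congrArg (fun q : Plane => q 0) h
        norm_num at h0
    intro j hj
    rw [inwardNormal_triangle, inwardNormal_triangle] at hj
    exact absurd hj (hne j)

theorem resolves_shrinkingTriangle :
    Resolves (triangle 1) (fun _ => 1) 2 shrinkingTriangle [] := by
  refine ⟨fun e => ?_, by simp, by simp⟩
  -- At time 2 the triangle has shrunk to its incenter, so dropping it altogether loses only one
  -- boundary point.
  refine (finite_singleton (!₂[1, 1] : Plane)).subset ?_
  have hv : ∀ j, shrinkingTriangle.vertex 2 j = !₂[1, 1] := by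
    have : shrinkingTriangle.vertex 2 = triangle 0 := by
      change triangle (1 - max 0 (2 - 1)) = triangle 0
      norm_num
    intro j
    rw [this]
    revert j
    change ∀ j : ZMod 3, _
    simp [forall_zmod_three, triangle_zero, triangle_one, triangle_two]
  rintro x (⟨hx, -⟩ | ⟨⟨hx, -⟩, -⟩)
  · simp at hx
  · simp only [fragments, mem_iUnion, edge, hv, segment_same] at hx
    obtain ⟨-, -, -, -, hx⟩ := hx
    exact hx

/-- The propagation process of the triangle in which all edges start to move at time `1`. -/
def trianglePropagation : Propagation (triangle 1) (fun _ => 1) where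
  N := 1
  time i := 2 * i
  polygons i := if i = 0 then [shrinkingTriangle] else []
  time_zero := by simp
  time_le i _ := by push_cast; linarith
  initial := ⟨_, rfl, shrinkingTriangle_vertex_of_le zero_le_one⟩
  moves i hi K hK := by
    obtain rfl : i = 0 := by omega
    obtain rfl : K = shrinkingTriangle := by simpa using hK
    simpa using movesBetween_shrinkingTriangle
  event i hi := by
    obtain rfl : i = 0 := by omega
    refine ⟨fun _ => [], fun K hK => ?_, by simp⟩
    obtain rfl : K = shrinkingTriangle := by simpa using hK
    simpa using resolves_shrinkingTriangle
  final := by simp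

theorem wavefront_trianglePropagation {t : ℝ} (h₀ : 0 ≤ t) (h₁ : t ≤ 1) :
    trianglePropagation.wavefront t = region (triangle 1) := by
  ext x
  constructor
  · rintro ⟨i, hi, -, -, K, hK, hx⟩
    obtain rfl : i = 0 := Nat.lt_one_iff.1 hi
    obtain rfl : K = shrinkingTriangle := List.mem_singleton.1 hK
    rwa [shrinkingTriangle_vertex_of_le h₁] at hx
  · intro hx
    refine ⟨0, Nat.one_pos, ?_, ?_, shrinkingTriangle, List.mem_singleton.2 rfl, ?_⟩
    · simpa [trianglePropagation] using h₀
    · simp [trianglePropagation]; linarith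
    · rwa [shrinkingTriangle_vertex_of_le h₁]

end StraightSkeleton

end

theorem mainTheorem1 :
    (∀ (n : ℕ) (p : ZMod n → StraightSkeleton.Plane), StraightSkeleton.IsSimplePolygon p →
      ∀ δ : ZMod n → ℝ, (∀ e, 0 ≤ δ e) →
      ∀ (W : StraightSkeleton.Propagation p δ) (t₁ t₂ : ℝ), 0 ≤ t₁ → t₁ < t₂ →
        W.wavefront t₂ ⊆ W.wavefront t₁) ∧
    (∃ (n : ℕ) (p : ZMod n → StraightSkeleton.Plane) (δ : ZMod n → ℝ)
      (W : StraightSkeleton.Propagation p δ) (t₁ t₂ : ℝ),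
        StraightSkeleton.IsSimplePolygon p ∧ (∀ e, 0 ≤ δ e) ∧ 0 ≤ t₁ ∧ t₁ < t₂ ∧
        (W.wavefront t₁).Nonempty ∧ W.wavefront t₂ = W.wavefront t₁) := by
  refine ⟨fun n p hp δ _ W t₁ t₂ h₁ h₁₂ => W.wavefront_subset hp h₁ h₁₂.le,
    3, StraightSkeleton.triangle 1, fun _ => 1, StraightSkeleton.trianglePropagation, 0, 1,
    StraightSkeleton.isSimplePolygon_triangle one_pos, fun _ => zero_le_one, le_rfl, one_pos, ?_, ?_⟩
  · rw [StraightSkeleton.wavefront_trianglePropagation le_rfl zero_le_one]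
    exact ⟨_, StraightSkeleton.curve_subset_region _
      (mem_iUnion.2 ⟨0, left_mem_segment ℝ _ _⟩)⟩
  · rw [StraightSkeleton.wavefront_trianglePropagation le_rfl zero_le_one,
      StraightSkeleton.wavefront_trianglePropagation zero_le_one le_rfl]
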